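/- Let $X$ be a completely regular Hausdorff space, $C(X)$ the ring of continuous functions $X\to\mathbb R$, and $\beta X$ the Stone–Čech compactification of $X$. An ideal $D$ of a commutative ring $A$ is (rationally) dense if its only annihilator in $A$ is $0$. The maximal ring of quotients of $A$ is the direct limit of the modules $\operatorname{Hom}_A(D,A)$ over all dense ideals $D$ of $A$ (two homomorphisms being identified when they agree on the intersection of their domains), with composition as multiplication. Let $Q(X)$ be the maximal ring of quotients of $C(X)$. If $\mathcal S$ is a nonempty family of dense subsets of a space $Y$ that is closed under finite intersection, let $C[\mathcal S]=\varinjlim_{S\in\mathcal S}C(S)$ be the ring of all continuous real functions on members of $\mathcal S$, where $f_1\in C(S_1)$ and $f_2\in C(S_2)$ are identified when they agree on $S_1\cap S_2$. It is a metric space under $$d(f,g)=\sup_{s}\frac{|f(s)-g(s)|}{1+|f(s)-g(s)|},$$ where the supremum is taken over a common domain in $\mathcal S$ and does not depend on its choice. Let $\mathcal V_0(Y)$ denote the family of all dense open subsets of $Y$ and $\mathcal G_0(Y)$ the family of all dense $G_\delta$ subsets of $Y$. For $Y$ a Baire space, $\mathcal G_0(Y)$ is closed under finite intersection and contains $\mathcal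 V_0(Y)$, so that $C[\mathcal V_0(Y)]\subset C[\mathcal G_0(Y)]$. Each $\varphi\in\operatorname{Hom}(D,C(X))$, with $D$ a dense ideal of $C(X)$, is multiplication by the continuous function $x\mapsto\varphi(d)(x)/d(x)$ ($d\in D$, $d(x)\ne0$) on the dense open set $\{x:\ d(x)\neq 0\text{ for some }d\in D\}$. In this way $Q(X)$ is embedded in $C[\mathcal V_0(X)]$, and it carries the metric $d$ of the latter. Let $\overline{Q}(X)$ be the metric completion of $Q(X)$. **Theorem.** $\overline{Q}(X)=C[\mathcal G_0(\beta X)]$; and if $X$ is a Baire space, then $\overline{Q}(X)=C[\mathcal G_0(X)]$. Explicitly: 1. There is an isometry of $\overline{Q}(X)$ onto $C[\mathcal G_0(\beta X)]$ whose restriction to $Q(X)$ is a ring homomorphism and sends each $q\in Q(X)$ to the class of a continuous function on a dense open subset $W$ of $\beta X$ whose restriction to $W\cap X$ represents $q$ in $C[\mathcal V_0(X)]$. 2. If $X$ is a Baire space, there is an isometry of $\overline{Q}(X)$ onto $C[\mathcal G_0(X)]$ whose restriction to $Q(X)$ is the canonical embedding $Q(X)\subset C[\mathcal V_0(X)]\subset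 C[\mathcal G_0(X)]$ and is a ring homomorphism. -/

import Mathlib

open Set Topology

noncomputable section

/-! ## The maximal ring of quotients of a commutative ring -/

/-- An ideal is rationally dense if its only annihilator in the ring is `0`. -/
def IsRatDense {A : Type*} [CommRing A] (D : Ideal A) : Prop :=
  ∀ a : A, (∀ d ∈ D, a * d = 0) → a = 0

/-- A rationally dense ideal `D` of `A` together with an element of `Hom(D, A)`. -/
structure DenseHom (A : Type*) [CommRing A] where
  dom : Ideal A
  dense : IsRatDense dom
  map : dom →ₗ[A] A

namespace DenseHom

variable {A : Type*} [CommRing A]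

theorem map_mul_right (φ : DenseHom A) (d e : A) (hd : d ∈ φ.dom) (h : d * e ∈ φ.dom) :
    φ.map ⟨d * e, h⟩ = φ.map ⟨d, hd⟩ * e := by
  have : (⟨d * e, h⟩ : φ.dom) = e • ⟨d, hd⟩ := Subtype.ext (by simp [mul_comm])
  rw [this, map_smul, smul_eq_mul, mul_comm]

theorem map_mul_comm (φ : DenseHom A) (d e : φ.dom) :
    φ.map d * (e : A) = φ.map e * (d : A) := by
  have h1 : (e : A) • d = (d : A) • e := Subtype.ext (by simp [mul_comm])
  have h2 := congrArg φ.map h1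
  rw [map_smul, map_smul, smul_eq_mul, smul_eq_mul] at h2
  linear_combination h2

/-- Two homomorphisms are identified when they agree on the intersection of their domains. -/
def Agree (φ ψ : DenseHom A) : Prop :=
  ∀ (d : A) (h₁ : d ∈ φ.dom) (h₂ : d ∈ ψ.dom), φ.map ⟨d, h₁⟩ = ψ.map ⟨d, h₂⟩

instance setoid (A : Type*) [CommRing A] : Setoid (DenseHom A) where
  r := Agree
  iseqv :=
    { refl := fun _ _ _ _ => rfl
      symm := fun h d h₁ h₂ => (h d h₂ h₁).symm
      trans := by
        intro φ ψ χ h k d h₁ h₃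
        rw [← sub_eq_zero]
        refine ψ.dense _ fun e he => ?_
        have p₁ := φ.dom.mul_mem_right e h₁
        have p₂ := ψ.dom.mul_mem_left d he
        have p₃ := χ.dom.mul_mem_right e h₃
        rw [sub_mul, ← φ.map_mul_right d e h₁ p₁, ← χ.map_mul_right d e h₃ p₃,
          h _ p₁ p₂, k _ p₂ p₃, sub_self] }

theorem dense_inf {D E : Ideal A} (hD : IsRatDense D) (hE : IsRatDense E) :
    IsRatDense (D ⊓ E) := by
  intro a ha
  refine hD a fun d hd => hE _ fun e he => ?_
  rw [mul_assoc]
  exact ha _ ⟨D.mul_mem_right e hd, E.mul_mem_left d he⟩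

theorem dense_top : IsRatDense (⊤ : Ideal A) := fun a ha => by
  simpa using ha 1 Submodule.mem_top

/-- Multiplication by `a`, as an element of `Hom(A, A)`. -/
def const (a : A) : DenseHom A where
  dom := ⊤
  dense := dense_top
  map := a • (⊤ : Ideal A).subtype

def add (φ ψ : DenseHom A) : DenseHom A where
  dom := φ.dom ⊓ ψ.dom
  dense := dense_inf φ.dense ψ.dense
  map := φ.map ∘ₗ Submodule.inclusion inf_le_left + ψ.map ∘ₗ Submodule.inclusion inf_le_right

def neg (φ : DenseHom A) : DenseHom A where
  dom := φ.dom
  dense := φ.dense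
  map := -φ.map

/-- The largest ideal on which the composition `φ ∘ ψ` is defined. -/
def compDom (φ ψ : DenseHom A) : Ideal A where
  carrier := {d | ∃ h : d ∈ ψ.dom, ψ.map ⟨d, h⟩ ∈ φ.dom}
  zero_mem' := ⟨ψ.dom.zero_mem, by
    have : (⟨0, ψ.dom.zero_mem⟩ : ψ.dom) = 0 := rfl
    rw [this, map_zero]; exact φ.dom.zero_mem⟩
  add_mem' := by
    rintro a b ⟨ha, ha'⟩ ⟨hb, hb'⟩
    refine ⟨ψ.dom.add_mem ha hb, ?_⟩
    have : (⟨a + b, ψ.dom.add_mem ha hb⟩ : ψ.dom) = ⟨a, ha⟩ + ⟨b, hb⟩ := rfl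
    rw [this, map_add]
    exact φ.dom.add_mem ha' hb'
  smul_mem' := by
    rintro c a ⟨ha, ha'⟩
    refine ⟨ψ.dom.smul_mem c ha, ?_⟩
    have : (⟨c • a, ψ.dom.smul_mem c ha⟩ : ψ.dom) = c • ⟨a, ha⟩ := rfl
    rw [this, map_smul]
    exact φ.dom.smul_mem c ha'

/-- The composition `φ ∘ ψ`. -/
def comp (φ ψ : DenseHom A) : DenseHom A where
  dom := compDom φ ψ
  dense := by
    intro a ha
    refine φ.dense a fun d hd => ψ.dense _ fun e he => ?_
    rw [mul_assoc, mul_comm d e]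
    have h : e * d ∈ ψ.dom := ψ.dom.mul_mem_right d he
    refine ha _ ⟨h, ?_⟩
    rw [ψ.map_mul_right e d he h]
    exact φ.dom.mul_mem_left _ hd
  map :=
    { toFun := fun d => φ.map ⟨ψ.map ⟨d.1, d.2.1⟩, d.2.2⟩
      map_add' := fun x y => by
        rw [← map_add]
        congr 1
        exact Subtype.ext (ψ.map.map_add ⟨x.1, x.2.1⟩ ⟨y.1, y.2.1⟩)
      map_smul' := fun c x => by
        rw [RingHom.id_apply, ← map_smul]
        congr 1
        exact Subtype.ext (ψ.map.map_smul c ⟨x.1, x.2.1⟩) }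

theorem comp_comm (φ ψ : DenseHom A) : Agree (comp φ ψ) (comp ψ φ) := by
  rintro d ⟨h₁, h₁'⟩ ⟨h₂, h₂'⟩
  change φ.map ⟨ψ.map ⟨d, h₁⟩, h₁'⟩ = ψ.map ⟨φ.map ⟨d, h₂⟩, h₂'⟩
  rw [← sub_eq_zero]
  refine φ.dense _ fun e he => ψ.dense _ fun f hf => ?_
  have a₁ := φ.map_mul_comm ⟨_, h₁'⟩ ⟨e, he⟩
  have a₂ := ψ.map_mul_comm ⟨_, h₂'⟩ ⟨f, hf⟩
  have a₃ := φ.map_mul_comm ⟨d, h₂⟩ ⟨e, he⟩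
  have a₄ := ψ.map_mul_comm ⟨d, h₁⟩ ⟨f, hf⟩
  simp only at a₁ a₂ a₃ a₄
  linear_combination f * a₁ - e * a₂ + φ.map ⟨e, he⟩ * a₄ - ψ.map ⟨f, hf⟩ * a₃

theorem comp_congr_right {φ ψ ψ' : DenseHom A} (h : Agree ψ ψ') :
    Agree (comp φ ψ) (comp φ ψ') := by
  rintro d ⟨h₁, h₁'⟩ ⟨h₂, h₂'⟩
  change φ.map ⟨ψ.map ⟨d, h₁⟩, h₁'⟩ = φ.map ⟨ψ'.map ⟨d, h₂⟩, h₂'⟩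
  congr 1
  exact Subtype.ext (h d h₁ h₂)

theorem comp_congr_left {φ φ' ψ : DenseHom A} (h : Agree φ φ') :
    Agree (comp φ ψ) (comp φ' ψ) := by
  rintro d ⟨h₁, h₁'⟩ ⟨h₂, h₂'⟩
  exact h _ h₁' h₂'

end DenseHom

/-- The maximal ring of quotients of `A`: the direct limit of the modules `Hom(D, A)` over all
rationally dense ideals `D`, with composition as multiplication. -/
def MaxRingOfQuotients (A : Type*) [CommRing A] : Type _ :=
  Quotient (DenseHom.setoid A)

namespace MaxRingOfQuotients

variable {A : Type*} [CommRing A]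

/-- The class of an element of `Hom(D, A)`. -/
def mk (φ : DenseHom A) : MaxRingOfQuotients A := Quotient.mk _ φ

instance : Zero (MaxRingOfQuotients A) := ⟨mk (DenseHom.const 0)⟩

instance : One (MaxRingOfQuotients A) := ⟨mk (DenseHom.const 1)⟩

instance : Neg (MaxRingOfQuotients A) :=
  ⟨Quotient.map DenseHom.neg fun _ _ h d h₁ h₂ => congrArg Neg.neg (h d h₁ h₂)⟩

instance : Add (MaxRingOfQuotients A) :=
  ⟨Quotient.map₂ DenseHom.add fun _ _ h _ _ k d h₁ h₂ =>
    congrArg₂ (· + ·) (h d h₁.1 h₂.1) (k d h₁.2 h₂.2)⟩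

instance : Mul (MaxRingOfQuotients A) :=
  ⟨Quotient.map₂ DenseHom.comp fun _ _ h _ _ k =>
    (DenseHom.setoid A).trans (DenseHom.comp_congr_left h) (DenseHom.comp_congr_right k)⟩

theorem mul_comm_aux (p q : MaxRingOfQuotients A) : p * q = q * p := by
  induction p using Quotient.inductionOn
  induction q using Quotient.inductionOn
  exact Quotient.sound (DenseHom.comp_comm _ _)

theorem one_mul_aux (p : MaxRingOfQuotients A) : 1 * p = p := by
  induction p using Quotient.inductionOn
  refine Quotient.sound fun d h₁ h₂ => ?_
  exact one_mul _

theorem zero_mul_aux (p : MaxRingOfQuotients A) : 0 * p = 0 := by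
  induction p using Quotient.inductionOn
  refine Quotient.sound fun d h₁ h₂ => ?_
  exact (zero_mul _).trans (zero_mul _).symm

theorem mul_add_aux (p q r : MaxRingOfQuotients A) : p * (q + r) = p * q + p * r := by
  induction p using Quotient.inductionOn with | _ φ
  induction q using Quotient.inductionOn
  induction r using Quotient.inductionOn
  refine Quotient.sound fun d h₁ h₂ => ?_
  exact φ.map.map_add ⟨_, h₂.1.2⟩ ⟨_, h₂.2.2⟩

instance : CommRing (MaxRingOfQuotients A) where
  add_assoc p q r := by
    induction p using Quotient.inductionOn
    induction q using Quotient.inductionOn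
    induction r using Quotient.inductionOn
    exact Quotient.sound fun d h₁ h₂ => add_assoc _ _ _
  zero_add p := by
    induction p using Quotient.inductionOn
    refine Quotient.sound fun d h₁ h₂ => ?_
    exact (congrArg (· + _) (zero_mul d)).trans (zero_add _)
  add_zero p := by
    induction p using Quotient.inductionOn
    refine Quotient.sound fun d h₁ h₂ => ?_
    exact (congrArg (_ + ·) (zero_mul d)).trans (add_zero _)
  add_comm p q := by
    induction p using Quotient.inductionOn
    induction q using Quotient.inductionOn
    exact Quotient.sound fun d h₁ h₂ => add_comm _ _
  neg_add_cancel p := by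
    induction p using Quotient.inductionOn
    refine Quotient.sound fun d h₁ h₂ => ?_
    exact (neg_add_cancel _).trans (zero_mul d).symm
  mul_assoc p q r := by
    induction p using Quotient.inductionOn
    induction q using Quotient.inductionOn
    induction r using Quotient.inductionOn
    exact Quotient.sound fun d h₁ h₂ => rfl
  mul_comm := mul_comm_aux
  one_mul := one_mul_aux
  mul_one p := (mul_comm_aux p 1).trans (one_mul_aux p)
  zero_mul := zero_mul_aux
  mul_zero p := (mul_comm_aux p 0).trans (zero_mul_aux p)
  left_distrib := mul_add_aux
  right_distrib p q r := by
    rw [mul_comm_aux, mul_add_aux, mul_comm_aux r p, mul_comm_aux r q]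
  nsmul := nsmulRec
  zsmul := zsmulRec

end MaxRingOfQuotients

/-! ## Rings of continuous functions on a filter base of dense sets -/

/-- A nonempty family of dense subsets of `X`, closed under finite intersection. -/
structure DenseFilterBase (X : Type*) [TopologicalSpace X] where
  sets : Set (Set X)
  nonempty : sets.Nonempty
  dense : ∀ S ∈ sets, Dense S
  inter : ∀ S ∈ sets, ∀ T ∈ sets, S ∩ T ∈ sets

/-- A continuous real function on some member `dom` of the family. It is given by a function on
`X` that is continuous on `dom`; its values outside `dom` are disregarded. -/
structure RealPartialFun {X : Type*} [TopologicalSpace X] (𝒮 : DenseFilterBase X) where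
  dom : Set X
  mem : dom ∈ 𝒮.sets
  toFun : X → ℝ
  cont : ContinuousOn toFun dom

theorem eqOn_of_dense {X : Type*} [TopologicalSpace X] {S T : Set X} {f g : X → ℝ}
    (hT : Dense T) (hTS : T ⊆ S) (hf : ContinuousOn f S) (hg : ContinuousOn g S)
    (h : EqOn f g T) : EqOn f g S :=
  h.of_subset_closure hf hg hTS fun x _ => hT x

namespace RealPartialFun

variable {X : Type*} [TopologicalSpace X] {𝒮 : DenseFilterBase X}

/-- Two functions are identified when they agree on the intersection of their domains. -/
instance setoid (𝒮 : DenseFilterBase X) : Setoid (RealPartialFun 𝒮) where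
  r f g := EqOn f.toFun g.toFun (f.dom ∩ g.dom)
  iseqv :=
    { refl := fun _ _ _ => rfl
      symm := fun h _ hx => (h hx.symm).symm
      trans := by
        intro f g k h₁ h₂
        refine eqOn_of_dense (T := (f.dom ∩ k.dom) ∩ g.dom)
          (𝒮.dense _ (𝒮.inter _ (𝒮.inter _ f.mem _ k.mem) _ g.mem)) inter_subset_left
          (f.cont.mono inter_subset_left) (k.cont.mono inter_subset_right) ?_
        rintro x ⟨⟨hf, hk⟩, hg⟩
        exact (h₁ ⟨hf, hg⟩).trans (h₂ ⟨hg, hk⟩) }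

def const (𝒮 : DenseFilterBase X) (c : ℝ) : RealPartialFun 𝒮 where
  dom := 𝒮.nonempty.choose
  mem := 𝒮.nonempty.choose_spec
  toFun := fun _ => c
  cont := continuousOn_const

def add (f g : RealPartialFun 𝒮) : RealPartialFun 𝒮 where
  dom := f.dom ∩ g.dom
  mem := 𝒮.inter _ f.mem _ g.mem
  toFun := fun x => f.toFun x + g.toFun x
  cont := (f.cont.mono inter_subset_left).add (g.cont.mono inter_subset_right)

def mul (f g : RealPartialFun 𝒮) : RealPartialFun 𝒮 where
  dom := f.dom ∩ g.dom
  mem := 𝒮.inter _ f.mem _ g.mem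
  toFun := fun x => f.toFun x * g.toFun x
  cont := (f.cont.mono inter_subset_left).mul (g.cont.mono inter_subset_right)

def neg (f : RealPartialFun 𝒮) : RealPartialFun 𝒮 where
  dom := f.dom
  mem := f.mem
  toFun := fun x => -f.toFun x
  cont := f.cont.neg

end RealPartialFun

/-- The direct limit `C[𝒮]` of the rings `C(S)`, `S ∈ 𝒮`: all continuous real functions on
members of `𝒮`, modulo agreement on the intersection of the domains. -/
def ContLimit {X : Type*} [TopologicalSpace X] (𝒮 : DenseFilterBase X) : Type _ :=
  Quotient (RealPartialFun.setoid 𝒮)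

namespace ContLimit

variable {X : Type*} [TopologicalSpace X] {𝒮 : DenseFilterBase X}

/-- The class of a continuous function on a member of `𝒮`. -/
def mk (f : RealPartialFun 𝒮) : ContLimit 𝒮 := Quotient.mk _ f

instance : Zero (ContLimit 𝒮) := ⟨mk (RealPartialFun.const 𝒮 0)⟩

instance : One (ContLimit 𝒮) := ⟨mk (RealPartialFun.const 𝒮 1)⟩

instance : Neg (ContLimit 𝒮) :=
  ⟨Quotient.map RealPartialFun.neg fun _ _ h _ hx => congrArg Neg.neg (h hx)⟩

instance : Add (ContLimit 𝒮) :=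
  ⟨Quotient.map₂ RealPartialFun.add fun _ _ h _ _ k _ hx =>
    congrArg₂ (· + ·) (h ⟨hx.1.1, hx.2.1⟩) (k ⟨hx.1.2, hx.2.2⟩)⟩

instance : Mul (ContLimit 𝒮) :=
  ⟨Quotient.map₂ RealPartialFun.mul fun _ _ h _ _ k _ hx =>
    congrArg₂ (· * ·) (h ⟨hx.1.1, hx.2.1⟩) (k ⟨hx.1.2, hx.2.2⟩)⟩

instance : CommRing (ContLimit 𝒮) where
  add_assoc p q r := by
    induction p using Quotient.inductionOn
    induction q using Quotient.inductionOn
    induction r using Quotient.inductionOn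
    exact Quotient.sound fun x _ => add_assoc _ _ _
  zero_add p := by
    induction p using Quotient.inductionOn
    exact Quotient.sound fun x _ => zero_add _
  add_zero p := by
    induction p using Quotient.inductionOn
    exact Quotient.sound fun x _ => add_zero _
  add_comm p q := by
    induction p using Quotient.inductionOn
    induction q using Quotient.inductionOn
    exact Quotient.sound fun x _ => add_comm _ _
  neg_add_cancel p := by
    induction p using Quotient.inductionOn
    exact Quotient.sound fun x _ => neg_add_cancel _
  mul_assoc p q r := by
    induction p using Quotient.inductionOn
    induction q using Quotient.inductionOn
    induction r using Quotient.inductionOn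
    exact Quotient.sound fun x _ => mul_assoc _ _ _
  mul_comm p q := by
    induction p using Quotient.inductionOn
    induction q using Quotient.inductionOn
    exact Quotient.sound fun x _ => mul_comm _ _
  one_mul p := by
    induction p using Quotient.inductionOn
    exact Quotient.sound fun x _ => one_mul _
  mul_one p := by
    induction p using Quotient.inductionOn
    exact Quotient.sound fun x _ => mul_one _
  zero_mul p := by
    induction p using Quotient.inductionOn
    exact Quotient.sound fun x _ => zero_mul _
  mul_zero p := by
    induction p using Quotient.inductionOn
    exact Quotient.sound fun x _ => mul_zero _
  left_distrib p q r := by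
    induction p using Quotient.inductionOn
    induction q using Quotient.inductionOn
    induction r using Quotient.inductionOn
    exact Quotient.sound fun x _ => mul_add _ _ _
  right_distrib p q r := by
    induction p using Quotient.inductionOn
    induction q using Quotient.inductionOn
    induction r using Quotient.inductionOn
    exact Quotient.sound fun x _ => add_mul _ _ _
  nsmul := nsmulRec
  zsmul := zsmulRec

end ContLimit

/-! ### The natural metric -/

/-- The bounded increasing function `r ↦ |r| / (1 + |r|)`. -/
def trunc (r : ℝ) : ℝ := |r| / (1 + |r|)

theorem trunc_nonneg (r : ℝ) : 0 ≤ trunc r := by unfold trunc; positivity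

theorem trunc_le_one (r : ℝ) : trunc r ≤ 1 := by
  unfold trunc
  rw [div_le_one (by positivity)]
  linarith

theorem trunc_continuous : Continuous trunc := by
  unfold trunc
  exact continuous_abs.div (continuous_const.add continuous_abs) fun r => by positivity

theorem trunc_eq_zero {r : ℝ} (h : trunc r = 0) : r = 0 := by
  unfold trunc at h
  rcases div_eq_zero_iff.mp h with h | h
  · exact abs_eq_zero.mp h
  · have := abs_nonneg r
    linarith

theorem trunc_add_le (r s : ℝ) : trunc (r + s) ≤ trunc r + trunc s := by
  unfold trunc
  have hr := abs_nonneg r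
  have hs := abs_nonneg s
  have h := abs_add_le r s
  have h0 := abs_nonneg (r + s)
  calc |r + s| / (1 + |r + s|) ≤ (|r| + |s|) / (1 + (|r| + |s|)) := by
        rw [div_le_div_iff₀ (by positivity) (by positivity)]
        nlinarith
    _ = |r| / (1 + (|r| + |s|)) + |s| / (1 + (|r| + |s|)) := add_div _ _ _
    _ ≤ |r| / (1 + |r|) + |s| / (1 + |s|) := by
        gcongr <;> linarith

/-- The supremum of `|f| / (1 + |f|)` over `S`. -/
def truncSup {X : Type*} (f : X → ℝ) (S : Set X) : ℝ := ⨆ x : S, trunc (f x)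

theorem bddAbove_trunc {X : Type*} (f : X → ℝ) (S : Set X) :
    BddAbove (range fun x : S => trunc (f x)) :=
  ⟨1, by rintro _ ⟨x, rfl⟩; exact trunc_le_one _⟩

theorem truncSup_nonneg {X : Type*} (f : X → ℝ) (S : Set X) : 0 ≤ truncSup f S :=
  Real.iSup_nonneg fun _ => trunc_nonneg _

theorem le_truncSup {X : Type*} (f : X → ℝ) {S : Set X} {x : X} (hx : x ∈ S) :
    trunc (f x) ≤ truncSup f S :=
  le_ciSup (bddAbove_trunc f S) ⟨x, hx⟩

theorem truncSup_le {X : Type*} {f : X → ℝ} {S : Set X} {c : ℝ} (hc : 0 ≤ c)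
    (h : ∀ x ∈ S, trunc (f x) ≤ c) : truncSup f S ≤ c :=
  Real.iSup_le (fun x => h x x.2) hc

theorem truncSup_congr {X : Type*} {f g : X → ℝ} {S : Set X} (h : EqOn f g S) :
    truncSup f S = truncSup g S :=
  iSup_congr fun x => by rw [h x.2]

/-- The supremum is determined by the values on any dense subset. -/
theorem truncSup_dense {X : Type*} [TopologicalSpace X] {f : X → ℝ} {S T : Set X}
    (hf : ContinuousOn f S) (hT : Dense T) (hTS : T ⊆ S) : truncSup f S = truncSup f T := by
  apply le_antisymm
  · refine truncSup_le (truncSup_nonneg _ _) fun x hx => ?_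
    have hc : ContinuousWithinAt (fun y => trunc (f y)) T x :=
      (trunc_continuous.comp_continuousOn hf x hx).mono hTS
    have : x ∈ closure T := hT x
    have hne : (𝓝[T] x).NeBot := mem_closure_iff_nhdsWithin_neBot.mp this
    refine le_of_tendsto hc ?_
    filter_upwards [self_mem_nhdsWithin] with y hy using le_truncSup f hy
  · exact truncSup_le (truncSup_nonneg _ _) fun x hx => le_truncSup f (hTS hx)

namespace ContLimit

variable {X : Type*} [TopologicalSpace X] {𝒮 : DenseFilterBase X}

/-- The supremum of `|f| / (1 + |f|)` over the domain of a representative `f`. -/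
def size : ContLimit 𝒮 → ℝ :=
  Quotient.lift (fun f : RealPartialFun 𝒮 => truncSup f.toFun f.dom) fun f g h => by
    have hd := 𝒮.dense _ (𝒮.inter _ f.mem _ g.mem)
    change truncSup f.toFun f.dom = truncSup g.toFun g.dom
    rw [truncSup_dense f.cont hd inter_subset_left, truncSup_dense g.cont hd inter_subset_right]
    exact truncSup_congr h

theorem size_mk (f : RealPartialFun 𝒮) : size (mk f) = truncSup f.toFun f.dom := rfl

theorem size_zero : size (0 : ContLimit 𝒮) = 0 := by
  refine le_antisymm (truncSup_le le_rfl fun x _ => ?_) (truncSup_nonneg _ _)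
  simp [RealPartialFun.const, trunc]

theorem size_neg (p : ContLimit 𝒮) : size (-p) = size p := by
  induction p using Quotient.inductionOn
  refine iSup_congr fun x => ?_
  simp [RealPartialFun.neg, trunc]

theorem size_add_le (p q : ContLimit 𝒮) : size (p + q) ≤ size p + size q := by
  induction p using Quotient.inductionOn
  induction q using Quotient.inductionOn
  refine truncSup_le (add_nonneg (truncSup_nonneg _ _) (truncSup_nonneg _ _)) fun x hx => ?_
  exact (trunc_add_le _ _).trans (add_le_add (le_truncSup _ hx.1) (le_truncSup _ hx.2))

theorem eq_zero_of_size (p : ContLimit 𝒮) (h : size p = 0) : p = 0 := by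
  induction p using Quotient.inductionOn with | _ f
  refine Quotient.sound fun x hx => trunc_eq_zero (le_antisymm ?_ (trunc_nonneg _))
  exact (le_truncSup f.toFun hx.1).trans h.le

/-- The distance of `f` and `g` is the supremum norm of `|f - g| / (1 + |f - g|)`. -/
instance : MetricSpace (ContLimit 𝒮) where
  dist p q := size (p - q)
  dist_self p := by simp [size_zero]
  dist_comm p q := by rw [← size_neg, neg_sub]
  dist_triangle p q r := by
    have := size_add_le (p - q) (q - r)
    rwa [sub_add_sub_cancel] at this
  eq_of_dist_eq_zero h := sub_eq_zero.mp (eq_zero_of_size _ h)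

/-- The inclusion of `C[𝒮]` in `C[𝒯]` for `𝒮 ⊆ 𝒯`. -/
def incl {𝒮 𝒯 : DenseFilterBase X} (h : 𝒮.sets ⊆ 𝒯.sets) : ContLimit 𝒮 → ContLimit 𝒯 :=
  Quotient.map (fun f => ⟨f.dom, h f.mem, f.toFun, f.cont⟩) fun _ _ hfg => hfg

end ContLimit

/-! ## Dense open sets and dense `G_δ` sets -/

/-- All dense open sets. -/
def denseOpens (X : Type*) [TopologicalSpace X] : DenseFilterBase X where
  sets := {V | IsOpen V ∧ Dense V}
  nonempty := ⟨univ, isOpen_univ, dense_univ⟩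
  dense _ h := h.2
  inter _ hS _ hT := ⟨hS.1.inter hT.1, hS.2.inter_of_isOpen_left hT.2 hS.1⟩

/-- All dense `G_δ` sets of a Baire space. -/
def denseGδs (X : Type*) [TopologicalSpace X] [BaireSpace X] : DenseFilterBase X where
  sets := {S | IsGδ S ∧ Dense S}
  nonempty := ⟨univ, isOpen_univ.isGδ, dense_univ⟩
  dense _ h := h.2
  inter _ hS _ hT := ⟨hS.1.inter hT.1, hS.2.inter_of_Gδ hS.1 hT.1 hT.2⟩

theorem denseOpens_subset_denseGδs (X : Type*) [TopologicalSpace X] [BaireSpace X] :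
    (denseOpens X).sets ⊆ (denseGδs X).sets := fun _ h => ⟨h.1.isGδ, h.2⟩

/-- Restriction to `X` of the continuous functions on dense open subsets of `βX`. -/
def restrictStoneCech (X : Type*) [TopologicalSpace X] [T35Space X] :
    ContLimit (denseOpens (StoneCech X)) → ContLimit (denseOpens X) :=
  Quotient.map
    (fun f =>
      { dom := stoneCechUnit ⁻¹' f.dom
        mem := by
          refine ⟨f.mem.1.preimage continuous_stoneCechUnit, ?_⟩
          have hi := (isDenseInducing_stoneCechUnit (X := X))
          rw [dense_iff_inter_open]
          intro U hU hne
          obtain ⟨W, hW, rfl⟩ := hi.isInducing.isOpen_iff.mp hU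
          obtain ⟨x, hx⟩ := hne
          obtain ⟨_, hy, z, rfl⟩ := hi.dense.inter_open_nonempty (W ∩ f.dom) (hW.inter f.mem.1)
            (f.mem.2.inter_open_nonempty W hW ⟨_, hx⟩)
          exact ⟨z, hy⟩
        toFun := fun x => f.toFun (stoneCechUnit x)
        cont := f.cont.comp continuous_stoneCechUnit.continuousOn fun _ hx => hx })
    fun _ _ h _ hx => h hx

/-! ## The ring `Q(X)` -/

/-- `Q(X)` is the maximal ring of quotients of `C(X)`. -/
abbrev QRing (X : Type*) [TopologicalSpace X] : Type _ := MaxRingOfQuotients C(X, ℝ)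

section Realize

variable {X : Type*} [TopologicalSpace X]

/-- The set of points at which some member of the ideal `D` does not vanish. -/
def coz (D : Ideal C(X, ℝ)) : Set X := {x | ∃ d ∈ D, d x ≠ 0}

theorem isOpen_coz (D : Ideal C(X, ℝ)) : IsOpen (coz D) := by
  have : coz D = ⋃ d ∈ D, {x | d x ≠ 0} := by ext; simp [coz]
  rw [this]
  exact isOpen_biUnion fun d _ => isOpen_ne_fun d.continuous continuous_const

theorem dense_coz [T35Space X] {D : Ideal C(X, ℝ)} (hD : IsRatDense D) : Dense (coz D) := by
  intro x
  by_contra hx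
  obtain ⟨f, hf, hfx, hfK⟩ :=
    CompletelyRegularSpace.completely_regular x (closure (coz D)) isClosed_closure hx
  let g : C(X, ℝ) := ⟨fun y => 1 - (f y : ℝ), by fun_prop⟩
  have hg : g = 0 := by
    refine hD g fun d hd => ?_
    ext y
    by_cases hy : d y = 0
    · simp [hy]
    · have : f y = 1 := hfK (subset_closure ⟨d, hd, hy⟩)
      simp [g, this]
  have h1 : g x = 1 := by simp [g, hfx]
  rw [hg] at h1
  simp at h1

open Classical in
/-- The function `x ↦ φ(d)(x) / d(x)` on `coz D`, where `d ∈ D` is any element with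
`d(x) ≠ 0`. -/
def realizeFun (φ : DenseHom C(X, ℝ)) (x : X) : ℝ :=
  if h : ∃ d : φ.dom, (d : C(X, ℝ)) x ≠ 0 then
    φ.map h.choose x / (h.choose : C(X, ℝ)) x
  else 0

theorem realizeFun_eq (φ : DenseHom C(X, ℝ)) (d : φ.dom) {x : X}
    (hx : (d : C(X, ℝ)) x ≠ 0) : realizeFun φ x = φ.map d x / (d : C(X, ℝ)) x := by
  have h : ∃ d : φ.dom, (d : C(X, ℝ)) x ≠ 0 := ⟨d, hx⟩
  rw [realizeFun, dif_pos h, div_eq_div_iff h.choose_spec hx]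
  exact DFunLike.congr_fun (φ.map_mul_comm h.choose d) x

theorem realizeFun_continuousOn (φ : DenseHom C(X, ℝ)) :
    ContinuousOn (realizeFun φ) (coz φ.dom) := by
  rintro x ⟨d, hd, hx⟩
  apply ContinuousAt.continuousWithinAt
  have h1 : ContinuousAt (fun y => φ.map ⟨d, hd⟩ y / d y) x :=
    (φ.map ⟨d, hd⟩).continuous.continuousAt.div d.continuous.continuousAt hx
  refine h1.congr ?_
  filter_upwards [(isOpen_ne_fun d.continuous continuous_const).mem_nhds hx] with y hy
  exact (realizeFun_eq φ ⟨d, hd⟩ hy).symm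

theorem realizeFun_agree {φ ψ : DenseHom C(X, ℝ)} (h : φ.Agree ψ) :
    EqOn (realizeFun φ) (realizeFun ψ) (coz φ.dom ∩ coz ψ.dom) := by
  rintro x ⟨⟨d, hd, hdx⟩, ⟨e, he, hex⟩⟩
  have p₁ := φ.dom.mul_mem_right e hd
  have p₂ := ψ.dom.mul_mem_left d he
  have hx : (d * e) x ≠ 0 := mul_ne_zero hdx hex
  rw [realizeFun_eq φ ⟨_, p₁⟩ hx, realizeFun_eq ψ ⟨_, p₂⟩ hx, h _ p₁ p₂]

/-- An element of `Hom(D, C(X))` acts on `D` as multiplication by a continuous function on the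
dense open set `coz D`; this is the resulting map from `Q(X)` to the ring of continuous functions
on dense open sets. -/
def realize [T35Space X] : QRing X → ContLimit (denseOpens X) :=
  Quotient.map
    (fun φ =>
      { dom := coz φ.dom
        mem := ⟨isOpen_coz _, dense_coz φ.dense⟩
        toFun := realizeFun φ
        cont := realizeFun_continuousOn φ })
    fun _ _ h => realizeFun_agree h

theorem realize_injective [T35Space X] : Function.Injective (realize (X := X)) := by
  intro p q
  induction p using Quotient.inductionOn with | _ φ
  induction q using Quotient.inductionOn with | _ ψ
  intro h
  have h' : EqOn (realizeFun φ) (realizeFun ψ) (coz φ.dom ∩ coz ψ.dom) := Quotient.exact h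
  refine Quotient.sound fun d h₁ h₂ => ?_
  have key : ∀ (χ : DenseHom C(X, ℝ)) (hd : d ∈ χ.dom), ∀ x ∈ coz χ.dom,
      χ.map ⟨d, hd⟩ x = realizeFun χ x * d x := by
    rintro χ hd x ⟨e, he, hx⟩
    rw [realizeFun_eq χ ⟨e, he⟩ hx, div_mul_eq_mul_div, eq_div_iff hx]
    exact DFunLike.congr_fun (χ.map_mul_comm ⟨d, hd⟩ ⟨e, he⟩) x
  have hdense : Dense (coz φ.dom ∩ coz ψ.dom) :=
    (dense_coz φ.dense).inter_of_isOpen_left (dense_coz ψ.dense) (isOpen_coz _)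
  refine DFunLike.coe_injective (Continuous.ext_on hdense (ContinuousMap.continuous _)
    (ContinuousMap.continuous _) fun x hx => ?_)
  rw [key φ h₁ x hx.1, key ψ h₂ x hx.2, h' hx]

/-- The natural metric of `Q(X)`, whose elements are regarded as continuous functions on dense
open sets: the supremum norm of `|f - g| / (1 + |f - g|)`. -/
instance [T35Space X] : MetricSpace (QRing X) :=
  MetricSpace.induced realize realize_injective inferInstance

end Realize

end

/-! Both completions are obtained by embedding `QRing X` isometrically, with dense range, in a
complete space of functions on dense `G_δ` sets. Three facts carry this.

Over a Baire space `Y` the ring `ContLimit (denseGδs Y)` is complete: a countable intersection of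
dense `G_δ` sets is again one, so a Cauchy sequence has a common domain, on which it converges
uniformly. The functions on dense open sets are dense in it
(`ContinuousOn.exists_denseOpen_approx`): a maximal disjoint family of open sets on which `f` varies
little has dense union, and a function constant on each member is continuous there.

The embedding of `Q(X)` in the functions on dense open sets of `X` is onto (`realize_surjective`):
given `f` on `V`, the elements `d` such that `f * d` extends continuously to `X` form a rationally
dense ideal, on which `f` acts by multiplication.

Restriction from `βX` to `X` is an isometric isomorphism between the two rings of functions on dense
open sets. Its surjectivity is algebraic: a homomorphism on a dense ideal of `C(X)` induces one on a
dense ideal of `C(βX)`, since multiplying by a suitable positive function makes both an element and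
its image bounded, hence extendable to `βX`. As `βX` is compact Hausdorff, it is Baire for every
`X`; the statement about `X` itself needs the Baire property. -/

open UniformSpace Filter

noncomputable section

/-! ### Completions as closures of isometric images -/

/-- An isometry with dense range into a complete space extends to an isometry of the completion
onto that space. -/
theorem Isometry.exists_completion_isometryEquiv {α β : Type*} [MetricSpace α] [MetricSpace β]
    [CompleteSpace β] {f : α → β} (hf : Isometry f) (hd : DenseRange f) :
    ∃ e : Completion α ≃ᵢ β, ∀ a : α, e (a : Completion α) = f a := by
  have hi := hf.completion_extension
  have hcoe : ∀ a : α, Completion.extension f (a : Completion α) = f a :=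
    Completion.extension_coe hf.uniformContinuous
  -- The isometric image of a complete space is closed, and this image contains the dense range of
  -- `f`.
  have hs : Function.Surjective (Completion.extension f) := by
    rw [← range_eq_univ, ← hi.isClosedEmbedding.isClosed_range.closure_eq]
    refine (hd.mono ?_).closure_eq
    rintro _ ⟨a, rfl⟩
    exact ⟨a, hcoe a⟩
  exact ⟨⟨Equiv.ofBijective _ ⟨hi.injective, hs⟩, hi⟩, hcoe⟩

/-! ### The truncation -/

theorem trunc_le_abs (r : ℝ) : trunc r ≤ |r| :=
  div_le_self (abs_nonneg r) (by linarith [abs_nonneg r])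

/-- The bound is `trunc ε`, and `trunc` increases with `|r|`. With `trunc_le_abs` this makes
convergence in the metric the same as uniform convergence. -/
theorem abs_lt_of_trunc_lt {r ε : ℝ} (hε : 0 < ε) (h : trunc r < ε / (1 + ε)) : |r| < ε := by
  have hr := abs_nonneg r
  unfold trunc at h
  rw [div_lt_div_iff₀ (by positivity) (by positivity)] at h
  linarith

namespace ContLimit

variable {X : Type*} [TopologicalSpace X] {𝒮 𝒯 : DenseFilterBase X}

theorem dist_eq_size (p q : ContLimit 𝒮) : dist p q = size (p - q) := rfl

theorem trunc_sub_le_dist (f g : RealPartialFun 𝒮) {x : X} (hf : x ∈ f.dom) (hg : x ∈ g.dom) :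
    trunc (f.toFun x - g.toFun x) ≤ dist (mk f) (mk g) := by
  rw [dist_eq_size, sub_eq_add_neg, sub_eq_add_neg]
  exact le_truncSup (fun x => f.toFun x + -g.toFun x) (S := f.dom ∩ g.dom) ⟨hf, hg⟩

theorem dist_mk_le {f g : RealPartialFun 𝒮} {ε : ℝ} (hε : 0 ≤ ε)
    (h : ∀ x ∈ f.dom ∩ g.dom, |f.toFun x - g.toFun x| ≤ ε) : dist (mk f) (mk g) ≤ ε := by
  rw [dist_eq_size, sub_eq_add_neg]
  refine truncSup_le hε fun x hx => (trunc_le_abs _).trans ?_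
  change |f.toFun x + -g.toFun x| ≤ ε
  rw [← sub_eq_add_neg]
  exact h x hx

/-! ### Inclusions -/

/-- The inclusion of `C[𝒮]` in `C[𝒯]` as a ring homomorphism. -/
def inclHom (h : 𝒮.sets ⊆ 𝒯.sets) : ContLimit 𝒮 →+* ContLimit 𝒯 where
  toFun := incl h
  map_zero' := Quotient.sound fun _ _ => rfl
  map_one' := Quotient.sound fun _ _ => rfl
  map_add' p q := by
    induction p using Quotient.inductionOn
    induction q using Quotient.inductionOn
    rfl
  map_mul' p q := by
    induction p using Quotient.inductionOn
    induction q using Quotient.inductionOn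
    rfl

theorem size_incl (h : 𝒮.sets ⊆ 𝒯.sets) (p : ContLimit 𝒮) : size (incl h p) = size p := by
  induction p using Quotient.inductionOn
  rfl

theorem isometry_incl (h : 𝒮.sets ⊆ 𝒯.sets) : Isometry (incl h) :=
  Isometry.of_dist_eq fun p q => by
    change size (inclHom h p - inclHom h q) = size (p - q)
    rw [← map_sub]
    exact size_incl h _

/-! ### Completeness of the ring of functions on dense `G_δ` sets -/

/-- By the Baire property the representatives of a Cauchy sequence share a dense `G_δ` domain, where
they are uniformly Cauchy; their uniform limit is continuous there. -/
instance instCompleteSpaceDenseGδs [BaireSpace X] : CompleteSpace (ContLimit (denseGδs X)) := by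
  refine Metric.complete_of_cauchySeq_tendsto fun u hu => ?_
  choose f hf using fun n => Quotient.exists_rep (u n)
  have hfu : u = fun n => mk (f n) := funext fun n => (hf n).symm
  subst hfu
  have hS : (⋂ n, (f n).dom) ∈ (denseGδs X).sets :=
    ⟨IsGδ.iInter fun n => (f n).mem.1,
      dense_iInter_of_Gδ (fun n => (f n).mem.1) fun n => (f n).mem.2⟩
  have hC : UniformCauchySeqOn (fun n => (f n).toFun) atTop (⋂ n, (f n).dom) := by
    rw [Metric.uniformCauchySeqOn_iff]
    intro ε hε
    obtain ⟨N, hN⟩ := Metric.cauchySeq_iff.mp hu (ε / (1 + ε)) (by positivity)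
    refine ⟨N, fun m hm n hn x hx => abs_lt_of_trunc_lt hε ?_⟩
    rw [mem_iInter] at hx
    exact (trunc_sub_le_dist (f m) (f n) (hx m) (hx n)).trans_lt (hN m hm n hn)
  -- The limit must be a total function on `X`; off the common domain its value is irrelevant.
  have hlim : ∀ x : X, ∃ y : ℝ, x ∈ (⋂ n, (f n).dom) →
      Tendsto (fun n => (f n).toFun x) atTop (𝓝 y) := by
    intro x
    by_cases hx : x ∈ ⋂ n, (f n).dom
    · obtain ⟨y, hy⟩ := cauchySeq_tendsto_of_complete (hC.cauchySeq hx)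
      exact ⟨y, fun _ => hy⟩
    · exact ⟨0, fun h => absurd h hx⟩
  choose F hF using hlim
  have hU := hC.tendstoUniformlyOn_of_tendsto hF
  refine ⟨mk ⟨_, hS, F, hU.continuousOn (Frequently.of_forall fun n =>
    (f n).cont.mono (iInter_subset _ n))⟩, Metric.tendsto_atTop.mpr fun ε hε => ?_⟩
  obtain ⟨N, hN⟩ := eventually_atTop.mp (Metric.tendstoUniformlyOn_iff.mp hU (ε / 2) (half_pos hε))
  refine ⟨N, fun n hn => (dist_mk_le (half_pos hε).le fun x hx => ?_).trans_lt (half_lt_self hε)⟩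
  have := hN n hn x hx.2
  rw [dist_comm] at this
  exact this.le

end ContLimit

/-! ### Approximation by locally constant functions on dense open sets -/

/-- A continuous function on a dense set is uniformly approximated, on that set, by a function
which is continuous on a dense open set. -/
theorem ContinuousOn.exists_denseOpen_approx {X : Type*} [TopologicalSpace X] {f : X → ℝ}
    {S : Set X} (hf : ContinuousOn f S) (hS : Dense S) {ε : ℝ} (hε : 0 < ε) :
    ∃ (V : Set X) (g : X → ℝ), IsOpen V ∧ Dense V ∧ ContinuousOn g V ∧
      ∀ x ∈ V ∩ S, |f x - g x| < ε := by
  classical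
  let P : Set X → Prop := fun U => IsOpen U ∧ U.Nonempty ∧ ∃ c : ℝ, ∀ x ∈ U ∩ S, |f x - c| < ε
  obtain ⟨𝒰, h𝒰⟩ := zorn_subset {𝒰 : Set (Set X) | 𝒰.PairwiseDisjoint id ∧ ∀ U ∈ 𝒰, P U} <| by
    intro c hc hchain
    refine ⟨⋃₀ c, ⟨?_, ?_⟩, fun s hs => subset_sUnion_of_mem hs⟩
    · exact (pairwiseDisjoint_sUnion hchain.directedOn).mpr fun s hs => (hc hs).1
    · rintro U ⟨s, hs, hU⟩
      exact (hc hs).2 U hU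
  obtain ⟨hdisj, hP⟩ := h𝒰.prop
  choose! c hc using fun U hU => (hP U hU).2.2
  have huniq : ∀ {U W x}, U ∈ 𝒰 → W ∈ 𝒰 → x ∈ U → x ∈ W → U = W := fun hU hW hxU hxW =>
    hdisj.elim_set hU hW _ hxU hxW
  let g : X → ℝ := fun x => if h : ∃ U ∈ 𝒰, x ∈ U then c h.choose else 0
  have hg : ∀ {U x}, U ∈ 𝒰 → x ∈ U → g x = c U := by
    intro U x hU hx
    have h : ∃ U ∈ 𝒰, x ∈ U := ⟨U, hU, hx⟩
    simp only [g, dif_pos h]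
    rw [huniq h.choose_spec.1 hU h.choose_spec.2 hx]
  refine ⟨⋃₀ 𝒰, g, isOpen_sUnion fun U hU => (hP U hU).1, ?_, ?_, ?_⟩
  -- If the union were not dense, continuity of `f` at a point of `S` outside its closure would give
  -- a further admissible set `W`, disjoint from all members. Maximality puts `W` in the family, so
  -- `W` is disjoint from itself although it contains that point.
  · by_contra hV
    rw [dense_iff_closure_eq, ← ne_eq, ← nonempty_compl] at hV
    obtain ⟨x, hxW, hxS⟩ := hS.inter_open_nonempty _ isClosed_closure.isOpen_compl hV
    obtain ⟨O, hO, hxO, hOS⟩ := mem_nhdsWithin.mp (hf x hxS (Metric.ball_mem_nhds (f x) hε))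
    set W := (closure (⋃₀ 𝒰))ᶜ ∩ O with hW
    have hWdisj : ∀ U ∈ 𝒰, Disjoint W U := fun U hU => Set.disjoint_left.mpr fun y hy hyU =>
      hy.1 (subset_closure (mem_sUnion_of_mem hyU hU))
    have hmem : insert W 𝒰 ∈ {𝒰 : Set (Set X) | 𝒰.PairwiseDisjoint id ∧ ∀ U ∈ 𝒰, P U} := by
      refine ⟨hdisj.insert fun U hU _ => hWdisj U hU, ?_⟩
      rintro U (rfl | hU)
      · exact ⟨isClosed_closure.isOpen_compl.inter hO, ⟨x, hxW, hxO⟩, f x,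
          fun y hy => hOS ⟨hy.1.2, hy.2⟩⟩
      · exact hP U hU
    have hW𝒰 : W ∈ 𝒰 := h𝒰.le_of_ge hmem (subset_insert _ _) (mem_insert _ _)
    exact Set.disjoint_left.mp (hWdisj W hW𝒰) ⟨hxW, hxO⟩ ⟨hxW, hxO⟩
  · rintro x ⟨U, hU, hx⟩
    have : g =ᶠ[𝓝 x] fun _ => c U := by
      filter_upwards [(hP U hU).1.mem_nhds hx] with y hy using hg hU hy
    exact (continuousAt_const.congr this.symm).continuousWithinAt
  · rintro x ⟨⟨U, hU, hx⟩, hxS⟩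
    rw [hg hU hx]
    exact hc U hU x ⟨hx, hxS⟩

theorem ContLimit.denseRange_incl (X : Type*) [TopologicalSpace X] [BaireSpace X] :
    DenseRange (ContLimit.incl (denseOpens_subset_denseGδs X)) := by
  refine Metric.denseRange_iff.mpr fun p ε hε => ?_
  induction p using Quotient.inductionOn with | _ f
  obtain ⟨V, g, hVo, hVd, hg, hfg⟩ := f.cont.exists_denseOpen_approx f.mem.2 (half_pos hε)
  refine ⟨ContLimit.mk ⟨V, ⟨hVo, hVd⟩, g, hg⟩, ?_⟩
  exact (ContLimit.dist_mk_le (half_pos hε).le fun x hx => (hfg x ⟨hx.2, hx.1⟩).le).trans_lt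
    (half_lt_self hε)

/-! ### Realization of `Q(X)` -/

section Realize

variable {X : Type*} [TopologicalSpace X]

/-- The point is that `d` may vanish at `x`: the quotient is taken with another `e` that does not,
and `φ(d) e = φ(e) d`. -/
theorem DenseHom.map_apply_eq (φ : DenseHom C(X, ℝ)) {d : C(X, ℝ)} (hd : d ∈ φ.dom) {x : X}
    (hx : x ∈ coz φ.dom) : φ.map ⟨d, hd⟩ x = realizeFun φ x * d x := by
  obtain ⟨e, he, hx⟩ := hx
  rw [realizeFun_eq φ ⟨e, he⟩ hx, div_mul_eq_mul_div, eq_div_iff hx]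
  exact DFunLike.congr_fun (φ.map_mul_comm ⟨d, hd⟩ ⟨e, he⟩) x

/-- Pointwise uniqueness of the multiplier, which spares every later computation the choice made in
`realizeFun`. -/
theorem realizeFun_eq_of_map_eq (φ : DenseHom C(X, ℝ)) {x : X} {r : ℝ} (hx : x ∈ coz φ.dom)
    (h : ∀ d : φ.dom, φ.map d x = r * (d : C(X, ℝ)) x) : realizeFun φ x = r := by
  obtain ⟨d, hd, hdx⟩ := hx
  rw [realizeFun_eq φ ⟨d, hd⟩ hdx, h, mul_div_cancel_right₀ _ hdx]

variable [T35Space X]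

/-- The realization of `Q(X)` by continuous functions on dense open sets, as a ring
homomorphism. -/
def realizeHom (X : Type*) [TopologicalSpace X] [T35Space X] :
    QRing X →+* ContLimit (denseOpens X) where
  toFun := realize
  map_zero' := Quotient.sound fun _ hx => realizeFun_eq_of_map_eq _ hx.1 fun _ => rfl
  map_one' := Quotient.sound fun _ hx => realizeFun_eq_of_map_eq _ hx.1 fun _ => rfl
  map_add' p q := by
    induction p using Quotient.inductionOn with | _ φ
    induction q using Quotient.inductionOn with | _ ψ
    refine Quotient.sound fun x hx => realizeFun_eq_of_map_eq _ hx.1 fun d => ?_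
    change φ.map ⟨d, d.2.1⟩ x + ψ.map ⟨d, d.2.2⟩ x = (realizeFun φ x + realizeFun ψ x) * _
    rw [φ.map_apply_eq d.2.1 hx.2.1, ψ.map_apply_eq d.2.2 hx.2.2, add_mul]
  map_mul' p q := by
    induction p using Quotient.inductionOn with | _ φ
    induction q using Quotient.inductionOn with | _ ψ
    refine Quotient.sound fun x hx => realizeFun_eq_of_map_eq _ hx.1 fun d => ?_
    change φ.map ⟨ψ.map ⟨d, d.2.1⟩, d.2.2⟩ x = realizeFun φ x * realizeFun ψ x * _
    rw [φ.map_apply_eq d.2.2 hx.2.1, ψ.map_apply_eq d.2.1 hx.2.2, mul_assoc]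

theorem isometry_realize : Isometry (realize (X := X)) := Isometry.of_dist_eq fun _ _ => rfl

/-- The ideal of the functions `d` for which `d * f` has a continuous extension from `V`. -/
def extendableIdeal (V : Set X) (f : X → ℝ) : Ideal C(X, ℝ) where
  carrier := {d | ∃ g : C(X, ℝ), ∀ x ∈ V, g x = f x * d x}
  zero_mem' := ⟨0, fun x _ => by simp⟩
  add_mem' := by
    rintro a b ⟨g, hg⟩ ⟨h, hh⟩
    exact ⟨g + h, fun x hx => by simp [hg x hx, hh x hx, mul_add]⟩
  smul_mem' := by
    rintro c a ⟨g, hg⟩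
    exact ⟨c * g, fun x hx => by simp [hg x hx, mul_left_comm]⟩

theorem exists_mem_extendableIdeal {V : Set X} {f : X → ℝ} (hV : IsOpen V)
    (hf : ContinuousOn f V) {x : X} (hx : x ∈ V) : ∃ d ∈ extendableIdeal V f, d x ≠ 0 := by
  obtain ⟨u, hu, hux, huV⟩ :=
    CompletelyRegularSpace.completely_regular x Vᶜ hV.isClosed_compl (by simpa using hx)
  have hu' : Continuous fun y => (u y : ℝ) := continuous_subtype_val.comp hu
  -- Cutting off at `1 / 2` makes `d` vanish on a neighbourhood of the complement of `V`, not merely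
  -- on it, so `f * d` is continuous even if `f` is unbounded near the boundary of `V`.
  let d : C(X, ℝ) := ⟨fun y => max 0 (1 / 2 - (u y : ℝ)), by fun_prop⟩
  have hc : Continuous fun y => f y * d y := by
    refine continuous_iff_continuousAt.mpr fun y => ?_
    by_cases hy : y ∈ V
    · exact (hf.continuousAt (hV.mem_nhds hy)).mul d.continuous.continuousAt
    · have h1 : (1 / 2 : ℝ) < u y := by
        have : u y = 1 := huV hy
        rw [this]; norm_num
      refine (continuousAt_const (y := (0 : ℝ))).congr ?_
      filter_upwards [(isOpen_lt continuous_const hu').mem_nhds h1] with z hz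
      have hz' : (1 / 2 : ℝ) < u z := hz
      have : d z = 0 := max_eq_left (by linarith)
      simp [this]
  refine ⟨d, ⟨⟨_, hc⟩, fun y _ => rfl⟩, ?_⟩
  have : d x = 1 / 2 := by simp [d, hux]
  rw [this]; norm_num

/-- Multiplication by `f` maps `extendableIdeal` to `C(X)`. The ideal is rationally dense because
its elements have no common zero in the dense set `V` on which `f` is defined. -/
theorem realize_surjective : Function.Surjective (realize (X := X)) := by
  intro p
  induction p using Quotient.inductionOn with | _ f
  have hd : IsRatDense (extendableIdeal f.dom f.toFun) := by
    intro a ha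
    refine DFunLike.coe_injective (Continuous.ext_on f.mem.2 a.continuous continuous_const ?_)
    intro x hx
    obtain ⟨d, hd, hdx⟩ := exists_mem_extendableIdeal f.mem.1 f.cont hx
    exact (mul_eq_zero.mp (DFunLike.congr_fun (ha d hd) x)).resolve_right hdx
  choose g hg using fun d : extendableIdeal f.dom f.toFun => d.2
  -- Extensions from a dense set are unique, so the chosen `g` is automatically linear.
  have hext : ∀ {a b : C(X, ℝ)}, EqOn a b f.dom → a = b := fun {a b} h =>
    DFunLike.coe_injective (Continuous.ext_on f.mem.2 a.continuous b.continuous h)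
  let φ : DenseHom C(X, ℝ) :=
    { dom := _
      dense := hd
      map :=
        { toFun := g
          map_add' := fun a b => hext fun x hx => by
            simp [hg _ x hx, mul_add]
          map_smul' := fun c a => hext fun x hx => by
            simp [hg _ x hx, mul_left_comm] } }
  refine ⟨MaxRingOfQuotients.mk φ, Quotient.sound fun x hx => ?_⟩
  exact realizeFun_eq_of_map_eq φ hx.1 fun d => hg d x hx.2

end Realize

/-! ### Restriction from the Stone–Čech compactification -/

section StoneCech

variable {X : Type*} [TopologicalSpace X]

/-- A bounded continuous real function extends to the Stone–Čech compactification. -/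
theorem exists_stoneCech_extension (f : C(X, ℝ)) {M : ℝ} (hM : ∀ x, |f x| ≤ M) :
    ∃ g : C(StoneCech X, ℝ), ∀ x, g (stoneCechUnit x) = f x := by
  let f' : X → Icc (-M) M := fun x => ⟨f x, abs_le.mp (hM x)⟩
  have hf' : Continuous f' := f.continuous.subtype_mk _
  refine ⟨⟨Subtype.val ∘ stoneCechExtend hf',
    continuous_subtype_val.comp (continuous_stoneCechExtend hf')⟩, fun x => ?_⟩
  exact congrArg Subtype.val (stoneCechExtend_stoneCechUnit hf' x)

/-- Restriction to `X` of the continuous functions on `βX`. -/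
def stoneCechRestrict (X : Type*) [TopologicalSpace X] : C(StoneCech X, ℝ) →+* C(X, ℝ) where
  toFun g := g.comp ⟨stoneCechUnit, continuous_stoneCechUnit⟩
  map_zero' := rfl
  map_one' := rfl
  map_add' _ _ := rfl
  map_mul' _ _ := rfl

theorem stoneCechRestrict_injective : Function.Injective (stoneCechRestrict X) := fun a b h =>
  DFunLike.coe_injective (denseRange_stoneCechUnit.equalizer a.continuous b.continuous
    (congrArg DFunLike.coe h))

/-- The functions on `βX` whose restriction `d` to `X` lies in the domain of `φ` and for which
`φ d` extends to `βX`. -/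
def stoneCechDom (φ : DenseHom C(X, ℝ)) : Ideal C(StoneCech X, ℝ) where
  carrier := {e | ∃ (h : stoneCechRestrict X e ∈ φ.dom) (g : C(StoneCech X, ℝ)),
    stoneCechRestrict X g = φ.map ⟨_, h⟩}
  zero_mem' := ⟨by simp, 0, by
    refine (map_zero (stoneCechRestrict X)).trans ((map_zero φ.map).symm.trans ?_)
    exact congrArg φ.map (Subtype.ext (by simp))⟩
  add_mem' := by
    rintro a b ⟨ha, g, hg⟩ ⟨hb, k, hk⟩
    refine ⟨by rw [map_add]; exact add_mem ha hb, g + k, ?_⟩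
    rw [map_add, hg, hk, ← map_add φ.map]
    exact congrArg φ.map (Subtype.ext (by simp))
  smul_mem' := by
    rintro c a ⟨ha, g, hg⟩
    refine ⟨by rw [smul_eq_mul, map_mul]; exact φ.dom.mul_mem_left _ ha, c * g, ?_⟩
    rw [map_mul, hg, ← smul_eq_mul, ← map_smul φ.map]
    exact congrArg φ.map (Subtype.ext (by simp))

/-- It suffices that the restriction of an annihilator `a` kills every `d` in the domain of `φ`. A
positive multiple of `d` extends to an element of `stoneCechDom φ`, and the positive factor cancels.
-/
theorem isRatDense_stoneCechDom (φ : DenseHom C(X, ℝ)) : IsRatDense (stoneCechDom φ) := by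
  intro a ha
  apply stoneCechRestrict_injective
  rw [map_zero]
  refine φ.dense _ fun d hd => ?_
  have hpos : ∀ x, 0 < (1 + d x ^ 2) * (1 + φ.map ⟨d, hd⟩ x ^ 2) := fun x => by positivity
  -- One factor bounds `d * w`, the other bounds `φ(d) * w = φ(d * w)`, both by `1`.
  let w : C(X, ℝ) := ⟨fun x => ((1 + d x ^ 2) * (1 + φ.map ⟨d, hd⟩ x ^ 2))⁻¹,
    Continuous.inv₀ (by fun_prop) fun x => (hpos x).ne'⟩
  have hw : ∀ x, 0 < w x := fun x => inv_pos.mpr (hpos x)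
  have hb : ∀ s t : ℝ, |s * ((1 + s ^ 2) * (1 + t ^ 2))⁻¹| ≤ 1 := by
    intro s t
    have h0 : 0 < (1 + s ^ 2) * (1 + t ^ 2) := by positivity
    rw [abs_mul, abs_inv, abs_of_pos h0, ← div_eq_mul_inv, div_le_one h0]
    have h1 : |s| ≤ 1 + s ^ 2 := by
      rw [← sq_abs]; nlinarith [sq_nonneg (|s| - 1), abs_nonneg s]
    exact h1.trans (le_mul_of_one_le_right (by positivity) (by nlinarith [sq_nonneg t]))
  obtain ⟨e, he⟩ := exists_stoneCech_extension (d * w) (M := 1) fun x => hb _ _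
  obtain ⟨g, hg⟩ := exists_stoneCech_extension (φ.map ⟨d, hd⟩ * w) (M := 1) fun x => by
    have := hb (φ.map ⟨d, hd⟩ x) (d x)
    rwa [mul_comm (1 + _)] at this
  have he' : stoneCechRestrict X e = d * w := ContinuousMap.ext he
  have hmem : d * w ∈ φ.dom := φ.dom.mul_mem_right w hd
  have hea : e ∈ stoneCechDom φ := by
    refine ⟨he' ▸ hmem, g, ?_⟩
    rw [show stoneCechRestrict X g = φ.map ⟨d, hd⟩ * w from ContinuousMap.ext hg,
      ← φ.map_mul_right d w hd hmem]
    exact congrArg φ.map (Subtype.ext he'.symm)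
  have h0 := congrArg (stoneCechRestrict X) (ha e hea)
  rw [map_mul, he', map_zero, ← mul_assoc] at h0
  ext x
  exact (mul_eq_zero.mp (DFunLike.congr_fun h0 x)).resolve_right (hw x).ne'

/-- The element of `Hom(D, C(βX))` induced by an element of `Hom(D, C(X))`. -/
def stoneCechDenseHom (φ : DenseHom C(X, ℝ)) : DenseHom C(StoneCech X, ℝ) where
  dom := stoneCechDom φ
  dense := isRatDense_stoneCechDom φ
  map :=
    -- The chosen extension of `φ(e|X)` is unique by density of `X` in `βX`, whence linearity.
    { toFun := fun e => e.2.choose_spec.choose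
      map_add' := fun a b => stoneCechRestrict_injective <| by
        rw [map_add, a.2.choose_spec.choose_spec, b.2.choose_spec.choose_spec,
          (a + b).2.choose_spec.choose_spec, ← map_add φ.map]
        exact congrArg φ.map (Subtype.ext (map_add (stoneCechRestrict X) a.1 b.1))
      map_smul' := fun c a => stoneCechRestrict_injective <| by
        rw [RingHom.id_apply, smul_eq_mul, map_mul, a.2.choose_spec.choose_spec,
          (c • a).2.choose_spec.choose_spec, ← smul_eq_mul, ← map_smul φ.map]
        exact congrArg φ.map (Subtype.ext (map_mul (stoneCechRestrict X) c a.1)) }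

theorem stoneCechDenseHom_map (φ : DenseHom C(X, ℝ)) (e : (stoneCechDenseHom φ).dom) (x : X) :
    (stoneCechDenseHom φ).map e (stoneCechUnit x) =
      φ.map ⟨stoneCechRestrict X e, e.2.choose⟩ x :=
  DFunLike.congr_fun e.2.choose_spec.choose_spec x

variable [T35Space X]

theorem exists_restrictStoneCech_eq_realize (q : QRing X) :
    ∃ p, restrictStoneCech X p = realize q := by
  induction q using Quotient.inductionOn with | _ φ
  refine ⟨realize (MaxRingOfQuotients.mk (stoneCechDenseHom φ)), Quotient.sound ?_⟩
  rintro x ⟨hx, hx'⟩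
  refine realizeFun_eq_of_map_eq (stoneCechDenseHom φ) hx fun e => ?_
  rw [stoneCechDenseHom_map, φ.map_apply_eq _ hx']
  rfl

/-- Restriction to `X` of the continuous functions on dense open subsets of `βX`, as a ring
homomorphism. -/
def restrictStoneCechHom (X : Type*) [TopologicalSpace X] [T35Space X] :
    ContLimit (denseOpens (StoneCech X)) →+* ContLimit (denseOpens X) where
  toFun := restrictStoneCech X
  map_zero' := Quotient.sound fun _ _ => rfl
  map_one' := Quotient.sound fun _ _ => rfl
  map_add' p q := by
    induction p using Quotient.inductionOn
    induction q using Quotient.inductionOn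
    rfl
  map_mul' p q := by
    induction p using Quotient.inductionOn
    induction q using Quotient.inductionOn
    rfl

/-- An open dense domain meets the image of `X` in a dense set, and the supremum is determined
there. -/
theorem size_restrictStoneCech (p : ContLimit (denseOpens (StoneCech X))) :
    (restrictStoneCech X p).size = p.size := by
  induction p using Quotient.inductionOn with | _ f
  change truncSup (fun x => f.toFun (stoneCechUnit x)) (stoneCechUnit ⁻¹' f.dom) =
    truncSup f.toFun f.dom
  have hd : Dense (f.dom ∩ range (stoneCechUnit : X → StoneCech X)) :=
    f.mem.2.inter_of_isOpen_left denseRange_stoneCechUnit f.mem.1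
  rw [truncSup_dense f.cont hd inter_subset_left]
  apply le_antisymm
  · exact truncSup_le (truncSup_nonneg _ _) fun x hx =>
      le_truncSup f.toFun (S := f.dom ∩ range stoneCechUnit) ⟨hx, x, rfl⟩
  · refine truncSup_le (truncSup_nonneg _ _) ?_
    rintro _ ⟨hx, x, rfl⟩
    exact le_truncSup (fun x => f.toFun (stoneCechUnit x)) (S := stoneCechUnit ⁻¹' f.dom) hx

theorem isometry_restrictStoneCech : Isometry (restrictStoneCech X) :=
  Isometry.of_dist_eq fun p q => by
    change (restrictStoneCechHom X p - restrictStoneCechHom X q).size = (p - q).size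
    rw [← map_sub]
    exact size_restrictStoneCech _

/-- Surjectivity passes through `Q(X)`: every function on a dense open set of `X` comes from some
`q`, and `q` transfers to `βX` by `stoneCechDenseHom`. -/
theorem restrictStoneCech_bijective : Function.Bijective (restrictStoneCech X) := by
  refine ⟨isometry_restrictStoneCech.injective, fun p => ?_⟩
  obtain ⟨q, rfl⟩ := realize_surjective p
  exact exists_restrictStoneCech_eq_realize q

/-- The continuous functions on dense open subsets of `βX` and of `X` form isomorphic rings. -/
def restrictStoneCechEquiv (X : Type*) [TopologicalSpace X] [T35Space X] :
    ContLimit (denseOpens (StoneCech X)) ≃+* ContLimit (denseOpens X) :=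
  RingEquiv.ofBijective (restrictStoneCechHom X) restrictStoneCech_bijective

theorem restrictStoneCech_symm_apply (p : ContLimit (denseOpens X)) :
    restrictStoneCech X ((restrictStoneCechEquiv X).symm p) = p :=
  (restrictStoneCechEquiv X).apply_symm_apply p

theorem isometry_restrictStoneCechEquiv_symm : Isometry (restrictStoneCechEquiv X).symm :=
  isometry_restrictStoneCech.right_inv restrictStoneCech_symm_apply

end StoneCech

end

/-- For a completely regular Hausdorff space `X`, the metric completion of `Q(X)` is the ring of
continuous functions on dense `G_δ` subsets of `βX`, and, if `X` is a Baire space, also the ring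
of continuous functions on dense `G_δ` subsets of `X`. The identifications are isometric, and on
`Q(X)` they are the canonical embeddings of rings of functions. -/
theorem mainTheorem3 (X : Type*) [TopologicalSpace X] [T35Space X] :
    (∃ (e : UniformSpace.Completion (QRing X) ≃ᵢ ContLimit (denseGδs (StoneCech X)))
        (ι : QRing X →+* ContLimit (denseGδs (StoneCech X))),
      (∀ q : QRing X, e (q : UniformSpace.Completion (QRing X)) = ι q) ∧
      ∀ q : QRing X, ∃ p : ContLimit (denseOpens (StoneCech X)),
        restrictStoneCech X p = realize q ∧
        ι q = ContLimit.incl (denseOpens_subset_denseGδs (StoneCech X)) p) ∧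
    (∀ [BaireSpace X],
      ∃ (e : UniformSpace.Completion (QRing X) ≃ᵢ ContLimit (denseGδs X))
        (ι : QRing X →+* ContLimit (denseGδs X)),
      (∀ q : QRing X, e (q : UniformSpace.Completion (QRing X)) = ι q) ∧
      ∀ q : QRing X, ι q = ContLimit.incl (denseOpens_subset_denseGδs X) (realize q)) := by
  refine ⟨?_, ?_⟩
  · have hi : Isometry (ContLimit.incl (denseOpens_subset_denseGδs (StoneCech X)) ∘
        (restrictStoneCechEquiv X).symm ∘ realize) :=
      (ContLimit.isometry_incl _).comp
        (isometry_restrictStoneCechEquiv_symm.comp isometry_realize)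
    have hd : DenseRange (ContLimit.incl (denseOpens_subset_denseGδs (StoneCech X)) ∘
        (restrictStoneCechEquiv X).symm ∘ realize) :=
      (ContLimit.denseRange_incl (StoneCech X)).comp
        ((restrictStoneCechEquiv X).symm.surjective.comp realize_surjective).denseRange
        (ContLimit.isometry_incl _).continuous
    obtain ⟨e, he⟩ := hi.exists_completion_isometryEquiv hd
    exact ⟨e, (ContLimit.inclHom (denseOpens_subset_denseGδs (StoneCech X))).comp
      ((restrictStoneCechEquiv X).symm.toRingHom.comp (realizeHom X)), he,
      fun q => ⟨_, restrictStoneCech_symm_apply (realize q), rfl⟩⟩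
  · intro _
    obtain ⟨e, he⟩ := ((ContLimit.isometry_incl (denseOpens_subset_denseGδs X)).comp
      isometry_realize).exists_completion_isometryEquiv
        ((ContLimit.denseRange_incl X).comp realize_surjective.denseRange
          (ContLimit.isometry_incl _).continuous)
    exact ⟨e, (ContLimit.inclHom (denseOpens_subset_denseGδs X)).comp (realizeHom X), he,
      fun _ => rfl⟩
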